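/- Let $i\in\{1,2\}$. A partition $\lambda=(\lambda_1,\dots,\lambda_r)$ of a positive integer $n$ (with $|\lambda|=n$ and $\mathrm{size}(\lambda)=r$) is called neighborly, written $\lambda\in\mathcal N_i(n)$, if (1) for every index $j$ there is an index $l\neq j$ with $|\lambda_l-\lambda_j|\le 1$; (2) every part occurs at most twice; (3) every part is at least $3-i$. To such a $\lambda$ one associates the simple graph $G_\lambda$ with a vertex $x_h$ for every part $h$ of $\lambda$ and a further vertex $y_h$ for every part $h$ that occurs twice; its edges are the pairs $\{x_{h+1},x_h\}$ and $\{x_l,y_l\}$ for all such vertices present in $G_\lambda$. The signature of $\lambda$ is $\delta(\lambda)=\sum_H(-1)^{|E(H)|}$, where $H$ ranges over the subgraphs of $G_\lambda$ with $V(H)=V(G_\lambda)$ and without isolated vertices. Let $\mathcal R_i(n)$ be the set of partitions of $n$ into distinct parts that are at least $3-i$ and congruent to $0$ or $\pm i$ modulo $5$, and let $\mathcal N_i=\bigcup_{n\ge1}\mathcal N_i(n)$. Then for every positive integer $n$, $$\sum_{\lambda\in\mathcal N_i(n)}\delta(\lambda)=\sum_{\lambda\in\mathcal R_i(n)}(-1)^{\mathrm{size}(\lambda)}.$$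 Equivalently, as an identity of formal power series in $q$ with integer coefficients (the infinite sum and product converging coefficientwise), $$1+\sum_{\lambda\in\mathcal N_i}\delta(\lambda)\,q^{|\lambda|}=\prod_{\substack{j\ge 3-i\\ j\equiv 0,\pm i\ (\mathrm{mod}\ 5)}}(1-q^j).$$ -/

import Mathlib

open scoped PowerSeries.WithPiTopology

noncomputable section

/-- `IsNeighborly i p`: the partition `p` lies in `N_i(n)`. A part other than the chosen
occurrence of `h` is an element of `p.parts.erase h`. -/
def IsNeighborly (i : ℕ) {n : ℕ} (p : n.Partition) : Prop :=
  (∀ h ∈ p.parts, ∃ k ∈ p.parts.erase h, |(k : ℤ) - (h : ℤ)| ≤ 1) ∧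
  (∀ h ∈ p.parts, p.parts.count h ≤ 2) ∧
  (∀ h ∈ p.parts, 3 - i ≤ h)

/-- The vertices of the graph of a partition: `x_h = (h, false)` for every part `h`, and
`y_h = (h, true)` for every part `h` of multiplicity `2`. -/
def partitionVertices {n : ℕ} (p : n.Partition) : Finset (ℕ × Bool) :=
  p.parts.toFinset.image (fun h => (h, false)) ∪
    (p.parts.toFinset.filter (fun h => p.parts.count h = 2)).image (fun h => (h, true))

/-- The graph `G_p`, with edges `{x_{h+1}, x_h}` and `{x_l, y_l}`. -/
def partitionGraph {n : ℕ} (p : n.Partition) : SimpleGraph (partitionVertices p) :=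
  SimpleGraph.fromRel fun u v =>
    (∃ h : ℕ, u.1 = (h + 1, false) ∧ v.1 = (h, false)) ∨
    (∃ l : ℕ, u.1 = (l, false) ∧ v.1 = (l, true))

open Classical in
/-- The signature `δ(p)`: the sum of `(-1)^|E(H)|` over the vertex-spanning subgraphs `H` of
`G_p` without isolated vertices. -/
def signature {n : ℕ} (p : n.Partition) : ℤ :=
  ∑ H : {H : (partitionGraph p).Subgraph // H.IsSpanning ∧ ∀ v ∈ H.verts, ∃ w, H.Adj v w},
    (-1) ^ H.1.edgeSet.ncard

/-- The integers `j ≥ 3 - i` with `j ≡ 0, ±i` modulo `5`. -/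
def IsNumeratorIndex (i j : ℕ) : Prop :=
  3 - i ≤ j ∧
    ((j : ℤ) ≡ 0 [ZMOD 5] ∨ (j : ℤ) ≡ (i : ℤ) [ZMOD 5] ∨ (j : ℤ) ≡ -(i : ℤ) [ZMOD 5])

open Classical in
/-- The set `N_i(n)`. -/
def neighborlyPartitions (i n : ℕ) : Finset n.Partition :=
  Finset.univ.filter fun p => IsNeighborly i p

open Classical in
/-- The set `R_i(n)`: partitions of `n` into distinct parts `≥ 3 - i`, each congruent to
`0` or `±i` modulo `5`. -/
def numeratorPartitions (i n : ℕ) : Finset n.Partition :=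
  Finset.univ.filter fun p => p.parts.Nodup ∧ ∀ h ∈ p.parts, IsNumeratorIndex i h

/-- The set `N_i`, the disjoint union of the `N_i(n)` over the positive integers `n`. -/
def allNeighborlyPartitions (i : ℕ) : Set (Σ n : ℕ, n.Partition) :=
  {p | 0 < p.1 ∧ IsNeighborly i p.2}

end

/-! A spanning subgraph of $G_\lambda$ without isolated vertices amounts to a finite edge set
covering exactly the vertices of $G_\lambda$, and the edge set determines $\lambda$. Hence
$1+\sum\delta(\lambda)q^{|\lambda|}$ is $A_{2-i}$, where $A_k$ is the signed generating function of
all finite edge sets on one infinite graph with vertices $x_h,y_h$, $h>k$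
(`sum_signature_eq_coeff_edgeSeries`).

Deciding which of the two lowest edges occur gives `edgeSeries_recurrence`, which for
$G_k=A_k/\prod_{j>k}(1-q^j)$ is the Rogers–Ramanujan recurrence $G_k=G_{k+1}+q^{k+1}G_{k+2}$.
Rogers' series satisfies the same recurrence (`rogersSum_recurrence`), and both families tend to $1$
as $k\to\infty$, so they agree (`X_pow_dvd_sub_rogersSum`).

For $k=0$ Rogers' series is a theta series, and for $k=1$ it becomes one after multiplication by
$1-q$. Jacobi's triple product (`X_pow_dvd_tripleProduct_sub_sum`) turns these into the products.
Infinite identities are handled as congruences modulo powers of $X$ between finite sums and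
products. -/

/-! ### Gaussian binomials and the finite triple product -/

section QBinomial

variable {R : Type*} [CommRing R]

/-- The Gaussian binomial coefficient `[n, k]` with base `q`. -/
def gaussBinom (q : R) : ℕ → ℕ → R
  | _, 0 => 1
  | 0, _ + 1 => 0
  | n + 1, k + 1 => gaussBinom q n k + q ^ (k + 1) * gaussBinom q n (k + 1)

/-- The `q`-factorial `(1 - q) (1 - q ^ 2) ⋯ (1 - q ^ n)`. -/
def qFactorial (q : R) (n : ℕ) : R := ∏ i ∈ Finset.range n, (1 - q ^ (i + 1))

theorem qFactorial_zero (q : R) : qFactorial q 0 = 1 := by simp [qFactorial]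

theorem qFactorial_succ (q : R) (n : ℕ) :
    qFactorial q (n + 1) = qFactorial q n * (1 - q ^ (n + 1)) :=
  Finset.prod_range_succ _ _

theorem gaussBinom_zero_right (q : R) (n : ℕ) : gaussBinom q n 0 = 1 := by
  cases n <;> rfl

theorem gaussBinom_succ_succ (q : R) (n k : ℕ) :
    gaussBinom q (n + 1) (k + 1) = gaussBinom q n k + q ^ (k + 1) * gaussBinom q n (k + 1) := rfl

theorem gaussBinom_eq_zero_of_lt (q : R) {n k : ℕ} (h : n < k) : gaussBinom q n k = 0 := by
  induction n generalizing k with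
  | zero => obtain ⟨k, rfl⟩ := Nat.exists_eq_succ_of_ne_zero h.ne'; rfl
  | succ n ih =>
    obtain ⟨k, rfl⟩ := Nat.exists_eq_succ_of_ne_zero (Nat.ne_zero_of_lt h)
    rw [gaussBinom_succ_succ, ih (by omega), ih (by omega)]
    simp

theorem gaussBinom_self (q : R) (n : ℕ) : gaussBinom q n n = 1 := by
  induction n with
  | zero => rfl
  | succ n ih => rw [gaussBinom_succ_succ, ih, gaussBinom_eq_zero_of_lt q n.lt_succ_self]; simp

/-- The dual Pascal rule, needed to adjoin the factors in $u$ to the triple product. For $k>n$ the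
truncated exponent is harmless, as all three coefficients vanish. -/
theorem gaussBinom_succ_succ' (q : R) (n k : ℕ) :
    gaussBinom q (n + 1) (k + 1) = gaussBinom q n (k + 1) + q ^ (n - k) * gaussBinom q n k := by
  induction n generalizing k with
  | zero => cases k <;> simp [gaussBinom]
  | succ n ih =>
    rcases lt_or_ge (n + 1) k with h | h
    · rw [gaussBinom_eq_zero_of_lt q (by omega : n + 1 + 1 < k + 1),
        gaussBinom_eq_zero_of_lt q (by omega : n + 1 < k + 1), gaussBinom_eq_zero_of_lt q h]
      simp
    rcases k with _ | k
    · have e1 := ih 0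
      have e2 := gaussBinom_succ_succ q n 0
      rw [gaussBinom_succ_succ q (n + 1)]
      simp only [gaussBinom_zero_right, Nat.sub_zero, zero_add] at e1 e2 ⊢
      linear_combination q * e1 - e2
    · rcases Nat.lt_or_ge k n with h' | h'
      · obtain ⟨d, rfl⟩ := Nat.exists_eq_add_of_lt h'
        have e1 := ih k
        have e2 := ih (k + 1)
        have f1 := gaussBinom_succ_succ q (k + d + 1) k
        have f2 := gaussBinom_succ_succ q (k + d + 1) (k + 1)
        rw [show k + d + 1 - k = d + 1 by omega] at e1
        rw [show k + d + 1 - (k + 1) = d by omega] at e2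
        rw [gaussBinom_succ_succ q (k + d + 1 + 1),
          show k + d + 1 + 1 - (k + 1) = d + 1 by omega]
        linear_combination e1 + q ^ (k + 2) * e2 - f2 - q ^ (d + 1) * f1
      · obtain rfl : k = n := by omega
        rw [gaussBinom_self, gaussBinom_self, gaussBinom_eq_zero_of_lt q (by omega : k + 1 < k + 1 + 1)]
        simp

theorem gaussBinom_mul_qFactorial (q : R) (i j : ℕ) :
    gaussBinom q (i + j) i * qFactorial q i * qFactorial q j = qFactorial q (i + j) := by
  induction h : i + j generalizing i j with
  | zero =>
    obtain ⟨rfl, rfl⟩ : i = 0 ∧ j = 0 := by omega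
    simp [qFactorial, gaussBinom]
  | succ n ih =>
    rcases i with _ | i
    · obtain rfl : j = n + 1 := by omega
      simp [gaussBinom_zero_right, qFactorial_zero]
    rcases j with _ | j
    · obtain rfl : i = n := by omega
      simp [gaussBinom_self, qFactorial_zero]
    have h1 := ih i (j + 1) (by omega)
    have h2 := ih (i + 1) j (by omega)
    obtain rfl : n = i + j + 1 := by omega
    rw [gaussBinom_succ_succ]
    rw [qFactorial_succ q j] at h1 ⊢
    rw [qFactorial_succ q i] at h2 ⊢
    rw [qFactorial_succ q (i + j + 1)]
    linear_combination (1 - q ^ (i + 1)) * h1 + q ^ (i + 1) * (1 - q ^ (j + 1)) * h2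

/-- The terms of Jacobi's triple product with `u * v = q`:
`(-1) ^ j * v ^ j * q ^ (j * (j - 1) / 2)` for every integer `j`. -/
def thetaTerm (u v q : R) : ℤ → R
  | Int.ofNat n => ∏ i ∈ Finset.range n, -(v * q ^ i)
  | Int.negSucc n => ∏ i ∈ Finset.range (n + 1), -(u * q ^ i)

theorem thetaTerm_natCast (u v q : R) (n : ℕ) :
    thetaTerm u v q n = ∏ i ∈ Finset.range n, -(v * q ^ i) := rfl

theorem thetaTerm_neg_natCast (u v q : R) (n : ℕ) :
    thetaTerm u v q (-n) = ∏ i ∈ Finset.range n, -(u * q ^ i) := by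
  cases n with
  | zero => simp [thetaTerm]
  | succ n => rfl

/-- Consecutive theta terms have ratio $-vq^j$, on the negative side because $uv=q$. Since $j$ may
be negative, $q^b$ with $b+j=a\ge 0$ clears the denominator. -/
theorem pow_mul_thetaTerm_add_one {u v q : R} (huv : u * v = q) {a b : ℕ} {j : ℤ}
    (h : (a : ℤ) = b + j) : q ^ b * thetaTerm u v q (j + 1) = -(v * q ^ a) * thetaTerm u v q j := by
  rcases le_or_gt 0 j with hj | hj
  · lift j to ℕ using hj
    obtain rfl : a = b + j := by omega
    rw [show (j : ℤ) + 1 = (j + 1 : ℕ) by simp, thetaTerm_natCast, thetaTerm_natCast,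
      Finset.prod_range_succ]
    ring
  · obtain ⟨c, rfl⟩ : ∃ c : ℕ, j = -((c + 1 : ℕ) : ℤ) := ⟨(-j - 1).toNat, by omega⟩
    rw [show -((c + 1 : ℕ) : ℤ) + 1 = -(c : ℤ) by push_cast; ring, thetaTerm_neg_natCast,
      thetaTerm_neg_natCast, Finset.prod_range_succ]
    obtain rfl : b = a + c + 1 := by omega
    linear_combination (-q ^ (a + c) * ∏ i ∈ Finset.range c, -(u * q ^ i)) * huv

theorem pow_mul_thetaTerm_sub_one {u v q : R} (huv : u * v = q) {a b : ℕ} {j : ℤ}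
    (h : (a : ℤ) = b - j) : q ^ b * thetaTerm u v q (j - 1) = -(u * q ^ a) * thetaTerm u v q j := by
  rcases le_or_gt j 0 with hj | hj
  · obtain ⟨c, rfl⟩ : ∃ c : ℕ, j = -(c : ℤ) := ⟨(-j).toNat, by omega⟩
    obtain rfl : a = b + c := by omega
    rw [show -(c : ℤ) - 1 = -((c + 1 : ℕ) : ℤ) by push_cast; ring, thetaTerm_neg_natCast,
      thetaTerm_neg_natCast, Finset.prod_range_succ]
    ring
  · obtain ⟨c, rfl⟩ : ∃ c : ℕ, j = ((c + 1 : ℕ) : ℤ) := ⟨(j - 1).toNat, by omega⟩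
    rw [show ((c + 1 : ℕ) : ℤ) - 1 = (c : ℤ) by push_cast; ring, thetaTerm_natCast,
      thetaTerm_natCast, Finset.prod_range_succ]
    obtain rfl : b = a + c + 1 := by omega
    linear_combination (-q ^ (a + c) * ∏ i ∈ Finset.range c, -(v * q ^ i)) * huv

/-- In the defining Pascal rule the part carrying $q^i$ absorbs $-vq^a$ through the ratio of
neighbouring theta terms. The companion for $u$ uses the dual rule. -/
theorem one_sub_mul_sum_gaussBinom_left {u v q : R} (huv : u * v = q) (n a : ℕ) :
    (1 - v * q ^ a) * ∑ i ∈ Finset.range (n + 1), gaussBinom q n i * thetaTerm u v q (a - i) =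
      ∑ i ∈ Finset.range (n + 2), gaussBinom q (n + 1) i * thetaTerm u v q ((a + 1 : ℕ) - i) := by
  have h : ∑ i ∈ Finset.range (n + 2), q ^ i * gaussBinom q n i *
      thetaTerm u v q ((a + 1 : ℕ) - i) = ∑ i ∈ Finset.range (n + 1), -(v * q ^ a) *
        (gaussBinom q n i * thetaTerm u v q (a - i)) := by
    rw [Finset.sum_range_succ, gaussBinom_eq_zero_of_lt q n.lt_succ_self, mul_zero, zero_mul,
      add_zero]
    refine Finset.sum_congr rfl fun i _ => ?_
    have := pow_mul_thetaTerm_add_one huv (a := a) (b := i) (j := a - i) (by ring)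
    rw [show ((a + 1 : ℕ) : ℤ) - i = a - i + 1 by push_cast; ring]
    linear_combination gaussBinom q n i * this
  rw [sub_mul, one_mul, sub_eq_add_neg, ← neg_mul, Finset.mul_sum, ← h,
    Finset.sum_range_succ' _ (n + 1), Finset.sum_range_succ' _ (n + 1)]
  simp only [gaussBinom_succ_succ, gaussBinom_zero_right, add_mul, Finset.sum_add_distrib]
  simp only [Nat.cast_add, Nat.cast_one, Nat.cast_zero, add_sub_add_right_eq_sub]
  ring

theorem one_sub_mul_sum_gaussBinom_right {u v q : R} (huv : u * v = q) (a b : ℕ) :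
    (1 - u * q ^ b) *
        ∑ i ∈ Finset.range (a + b + 1), gaussBinom q (a + b) i * thetaTerm u v q (a - i) =
      ∑ i ∈ Finset.range (a + b + 2), gaussBinom q (a + b + 1) i * thetaTerm u v q (a - i) := by
  have h : ∑ i ∈ Finset.range (a + b + 1), q ^ (a + b - i) * gaussBinom q (a + b) i *
      thetaTerm u v q (a - (i + 1 : ℕ)) = ∑ i ∈ Finset.range (a + b + 1), -(u * q ^ b) *
        (gaussBinom q (a + b) i * thetaTerm u v q (a - i)) := by
    refine Finset.sum_congr rfl fun i hi => ?_
    have hi := Finset.mem_range.1 hi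
    have := pow_mul_thetaTerm_sub_one huv (a := b) (b := a + b - i) (j := a - i) (by omega)
    rw [show (a : ℤ) - (i + 1 : ℕ) = a - i - 1 by push_cast; ring]
    linear_combination gaussBinom q (a + b) i * this
  have h' : ∑ i ∈ Finset.range (a + b + 1), gaussBinom q (a + b) i * thetaTerm u v q (a - i) =
      ∑ i ∈ Finset.range (a + b + 2), gaussBinom q (a + b) i * thetaTerm u v q (a - i) := by
    rw [Finset.sum_range_succ _ (a + b + 1), gaussBinom_eq_zero_of_lt q (a + b).lt_succ_self]
    simp
  rw [sub_mul, one_mul, sub_eq_add_neg, ← neg_mul, Finset.mul_sum, ← h, h',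
    Finset.sum_range_succ' _ (a + b + 1), Finset.sum_range_succ' _ (a + b + 1)]
  simp only [gaussBinom_succ_succ', gaussBinom_zero_right, add_mul, Finset.sum_add_distrib]
  ring

/-- The finite form of Jacobi's triple product identity. -/
theorem prod_mul_prod_eq_sum_gaussBinom {u v q : R} (huv : u * v = q) (a b : ℕ) :
    (∏ l ∈ Finset.range a, (1 - v * q ^ l)) * ∏ l ∈ Finset.range b, (1 - u * q ^ l) =
      ∑ i ∈ Finset.range (a + b + 1), gaussBinom q (a + b) i * thetaTerm u v q (a - i) := by
  induction b with
  | zero =>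
    induction a with
    | zero => simp [gaussBinom, show thetaTerm u v q 0 = 1 from rfl]
    | succ a ih =>
      simp only [Finset.range_zero, Finset.prod_empty, mul_one, add_zero] at ih ⊢
      rw [Finset.prod_range_succ, ih, mul_comm, one_sub_mul_sum_gaussBinom_left huv]
  | succ b ih =>
    rw [Finset.prod_range_succ, ← mul_assoc, ih, mul_comm, one_sub_mul_sum_gaussBinom_right huv]
    rfl

/-- The quotient $w$ is a product of factors $1-q^i$ with $i>n$. -/
theorem pow_dvd_qFactorial_add (q : R) (n d : ℕ) :
    ∃ w, qFactorial q (n + d) = qFactorial q n * w ∧ q ^ (n + 1) ∣ w - 1 := by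
  induction d with
  | zero => exact ⟨1, by simp, by simp⟩
  | succ d ih =>
    obtain ⟨w, hw, z, hz⟩ := ih
    refine ⟨w * (1 - q ^ (n + d + 1)), ?_, z - q ^ d * w, ?_⟩
    · rw [← add_assoc, qFactorial_succ, hw, mul_assoc]
    · linear_combination hz

theorem pow_dvd_qFactorial_mul_sub_one [IsDomain R] {q : R} (hq : ∀ n, qFactorial q n ≠ 0)
    {c : R} {m j : ℕ} (hj : j ≤ m)
    (h : c * qFactorial q (m - j) * qFactorial q (m + 1 + j) = qFactorial q (2 * m + 1)) :
    q ^ (m - j + 1) ∣ qFactorial q m * c - 1 := by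
  obtain ⟨v, hv, hv'⟩ := pow_dvd_qFactorial_add q (m - j) j
  obtain ⟨w, hw, hw'⟩ := pow_dvd_qFactorial_add q (m + 1 + j) (m - j)
  rw [Nat.sub_add_cancel hj] at hv
  rw [show m + 1 + j + (m - j) = 2 * m + 1 by omega, ← h, mul_comm] at hw
  have hc := mul_left_cancel₀ (hq _) hw
  have hw'' := (pow_dvd_pow q (by omega : m - j + 1 ≤ m + 1 + j + 1)).trans hw'
  -- With $v=(q)_m/(q)_{m-j}$ and $w=(q)_{2m+1}/(q)_{m+1+j}$, the product $(q)_m c$ equals $vw$, and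
  -- both factors are $1$ modulo $q^{m-j+1}$.
  have e : qFactorial q m * c - 1 = (v - 1) * w + (w - 1) := by
    rw [hv, ← hc]; ring
  rw [e]
  exact (hv'.mul_right _).add hw''

end QBinomial

/-! ### Jacobi's triple product modulo powers of $X$ -/

open PowerSeries

theorem qFactorial_X_pow_ne_zero {r : ℕ} (hr : r ≠ 0) (n : ℕ) :
    qFactorial (X ^ r : ℤ⟦X⟧) n ≠ 0 := by
  refine Finset.prod_ne_zero_iff.2 fun i _ h => ?_
  have := congrArg constantCoeff h
  simp [hr] at this

theorem X_pow_dvd_prod_neg {a r : ℕ} (ha : 0 < a) (j : ℕ) :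
    (X : ℤ⟦X⟧) ^ j ∣ ∏ i ∈ Finset.range j, -((X : ℤ⟦X⟧) ^ a * (X ^ r) ^ i) := by
  rw [← Finset.card_range j, ← Finset.prod_const, Finset.card_range]
  refine Finset.prod_dvd_prod_of_dvd _ _ fun i _ => ?_
  exact ((dvd_pow_self _ ha.ne').mul_right _).neg_right

/-- Jacobi's triple product identity, up to the order `m + 1`. -/
theorem X_pow_dvd_tripleProduct_sub_sum {a b : ℕ} (ha : 0 < a) (hb : 0 < b) (m : ℕ) :
    (X : ℤ⟦X⟧) ^ (m + 1) ∣
      (∏ l ∈ Finset.range m, ((1 - X ^ ((a + b) * (l + 1))) * (1 - X ^ ((a + b) * l + a)) *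
        (1 - X ^ ((a + b) * l + b)))) -
      ∑ j ∈ Finset.range (m + 1), (∏ i ∈ Finset.range j, -(X : ℤ⟦X⟧) ^ ((a + b) * i + b)) *
        (1 - X ^ (a * (2 * j + 1))) := by
  set q : ℤ⟦X⟧ := X ^ (a + b) with hq
  set u : ℤ⟦X⟧ := X ^ a with hu
  set v : ℤ⟦X⟧ := X ^ b with hv
  have huv : u * v = q := by rw [hu, hv, hq, pow_add]
  have hne : ∀ n, qFactorial q n ≠ 0 := qFactorial_X_pow_ne_zero (by omega)
  have hXq : ∀ n, (X : ℤ⟦X⟧) ^ n ∣ q ^ n := fun n => pow_dvd_pow_of_dvd (dvd_pow_self _ (by omega)) n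
  have hsum : ∑ j ∈ Finset.range (m + 1), (∏ i ∈ Finset.range j, -(X : ℤ⟦X⟧) ^ ((a + b) * i + b)) *
        (1 - X ^ (a * (2 * j + 1))) =
      ∑ j ∈ Finset.range (m + 1), thetaTerm u v q j +
        ∑ j ∈ Finset.range (m + 1), thetaTerm u v q (-(j + 1 : ℕ)) := by
    rw [← Finset.sum_add_distrib]
    refine Finset.sum_congr rfl fun j _ => ?_
    have h1 : ∏ i ∈ Finset.range j, -(X : ℤ⟦X⟧) ^ ((a + b) * i + b) = thetaTerm u v q j := by
      rw [thetaTerm_natCast]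
      refine Finset.prod_congr rfl fun i _ => ?_
      rw [hv, hq]; ring
    have h2 : ∀ n : ℕ, thetaTerm u v q (-(n + 1 : ℕ)) = -u ^ (2 * n + 1) * thetaTerm u v q n := by
      intro n
      rw [thetaTerm_neg_natCast, thetaTerm_natCast]
      induction n with
      | zero => simp
      | succ n ih =>
        rw [Finset.prod_range_succ, ih, Finset.prod_range_succ]
        linear_combination
          (-u ^ (2 * n + 2) * q ^ n * ∏ x ∈ Finset.range n, -(v * q ^ x)) * huv
    rw [h1, h2, hu]; ring
  have hprod : ∏ l ∈ Finset.range m, ((1 - X ^ ((a + b) * (l + 1))) * (1 - X ^ ((a + b) * l + a)) *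
        (1 - (X : ℤ⟦X⟧) ^ ((a + b) * l + b))) = qFactorial q m *
      ((∏ l ∈ Finset.range m, (1 - v * q ^ l)) * ∏ l ∈ Finset.range m, (1 - u * q ^ l)) := by
    rw [qFactorial, ← Finset.prod_mul_distrib, ← Finset.prod_mul_distrib]
    refine Finset.prod_congr rfl fun l _ => ?_
    rw [hu, hv, hq]; ring
  set P := qFactorial q m *
      ((∏ l ∈ Finset.range m, (1 - v * q ^ l)) * ∏ l ∈ Finset.range m, (1 - u * q ^ l)) with hP
  -- An extra factor in $u$ makes the theta index run from $-(m+1)$ to $m$, so that $j$ pairs with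
  -- $-(j+1)$.
  have hlast : (X : ℤ⟦X⟧) ^ (m + 1) ∣ P - P * (1 - u * q ^ m) := by
    rw [show P - P * (1 - u * q ^ m) = P * (u * q ^ m) by ring, pow_succ']
    exact (mul_dvd_mul (dvd_pow_self _ ha.ne') (hXq m)).mul_left _
  have hP' : P * (1 - u * q ^ m) = ∑ j ∈ Finset.range (m + 1),
        qFactorial q m * gaussBinom q (2 * m + 1) (m - j) * thetaTerm u v q j +
      ∑ j ∈ Finset.range (m + 1),
        qFactorial q m * gaussBinom q (2 * m + 1) (m + 1 + j) * thetaTerm u v q (-(j + 1 : ℕ)) := by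
    rw [hP, mul_assoc, mul_assoc, ← Finset.prod_range_succ, prod_mul_prod_eq_sum_gaussBinom huv,
      show m + (m + 1) + 1 = (m + 1) + (m + 1) by ring, Finset.sum_range_add, mul_add,
      ← Finset.sum_range_reflect, Finset.mul_sum, Finset.mul_sum,
      show m + (m + 1) = 2 * m + 1 by ring]
    congr 1
    · refine Finset.sum_congr rfl fun j hj => ?_
      have hj := Finset.mem_range.1 hj
      rw [show m + 1 - 1 - j = m - j by omega, show (m : ℤ) - (m - j : ℕ) = j by omega, mul_assoc]
    · refine Finset.sum_congr rfl fun j hj => ?_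
      rw [show (m : ℤ) - (m + 1 + j : ℕ) = -(j + 1 : ℕ) by push_cast; ring, mul_assoc]
  -- The coefficient is $1$ only up to order $m-j+1$; the theta term supplies the missing $X^j$.
  have key : ∀ (c t : ℤ⟦X⟧) (j : ℕ), j ≤ m →
      c * qFactorial q (m - j) * qFactorial q (m + 1 + j) = qFactorial q (2 * m + 1) →
      (X : ℤ⟦X⟧) ^ j ∣ t → (X : ℤ⟦X⟧) ^ (m + 1) ∣ qFactorial q m * c * t - t := by
    intro c t j hj hc ht
    have := mul_dvd_mul ((hXq _).trans (pow_dvd_qFactorial_mul_sub_one hne hj hc)) ht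
    rwa [← pow_add, show m - j + 1 + j = m + 1 by omega, sub_mul, one_mul] at this
  rw [hprod, hsum, ← sub_add_sub_cancel P (P * (1 - u * q ^ m))]
  refine dvd_add hlast ?_
  rw [hP', add_sub_add_comm, ← Finset.sum_sub_distrib, ← Finset.sum_sub_distrib]
  refine dvd_add (Finset.dvd_sum fun j hj => ?_) (Finset.dvd_sum fun j hj => ?_)
  · have hj : j ≤ m := Nat.lt_succ_iff.1 (Finset.mem_range.1 hj)
    refine key _ _ j hj ?_ (X_pow_dvd_prod_neg hb j)
    have := gaussBinom_mul_qFactorial q (m - j) (m + 1 + j)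
    rwa [show m - j + (m + 1 + j) = 2 * m + 1 by omega] at this
  · have hj : j ≤ m := Nat.lt_succ_iff.1 (Finset.mem_range.1 hj)
    refine key _ _ j hj ?_ ?_
    · have := gaussBinom_mul_qFactorial q (m + 1 + j) (m - j)
      rw [show m + 1 + j + (m - j) = 2 * m + 1 by omega] at this
      rw [← this]; ring
    · rw [thetaTerm_neg_natCast]
      exact (pow_dvd_pow _ j.le_succ).trans (X_pow_dvd_prod_neg ha (j + 1))

/-! ### Rogers' series and its recurrence -/

theorem qFactorial_X_ne_zero (n : ℕ) : qFactorial (X : ℤ⟦X⟧) n ≠ 0 := by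
  simpa using qFactorial_X_pow_ne_zero one_ne_zero n

theorem one_sub_mul_gaussBinom_succ_left (k n : ℕ) :
    (1 - X ^ (k + 1)) * gaussBinom (X : ℤ⟦X⟧) (n + (k + 1)) n =
      (1 - X ^ (k + n + 1)) * gaussBinom X (n + k) n := by
  apply mul_right_cancel₀ (mul_ne_zero (qFactorial_X_ne_zero n) (qFactorial_X_ne_zero k))
  have h1 := gaussBinom_mul_qFactorial (X : ℤ⟦X⟧) n k
  have h2 := gaussBinom_mul_qFactorial (X : ℤ⟦X⟧) n (k + 1)
  rw [← add_assoc, qFactorial_succ, qFactorial_succ] at h2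
  rw [← add_assoc]
  linear_combination h2 - (1 - X ^ (k + n + 1)) * h1

theorem one_sub_mul_gaussBinom_succ_right (k n : ℕ) :
    (1 - X ^ (n + 1)) * gaussBinom (X : ℤ⟦X⟧) (n + 1 + k) (n + 1) =
      (1 - X ^ (k + n + 1)) * gaussBinom X (n + k) n := by
  apply mul_right_cancel₀ (mul_ne_zero (qFactorial_X_ne_zero n) (qFactorial_X_ne_zero k))
  have h1 := gaussBinom_mul_qFactorial (X : ℤ⟦X⟧) n k
  have h2 := gaussBinom_mul_qFactorial (X : ℤ⟦X⟧) (n + 1) k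
  rw [add_right_comm, qFactorial_succ, qFactorial_succ] at h2
  rw [add_right_comm]
  linear_combination h2 - (1 - X ^ (k + n + 1)) * h1

/-- The sign and power of `X` in the terms of Rogers' series:
`(-1) ^ n * X ^ (2 * k * n + n * (5 * n - 1) / 2)`. -/
noncomputable def rogersMonomial (k n : ℕ) : ℤ⟦X⟧ :=
  ∏ i ∈ Finset.range n, -X ^ (2 * k + 5 * i + 2)

theorem rogersMonomial_succ (k n : ℕ) :
    rogersMonomial k (n + 1) = -X ^ (2 * k + 5 * n + 2) * rogersMonomial k n := by
  rw [rogersMonomial, Finset.prod_range_succ, mul_comm]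
  rfl

theorem rogersMonomial_succ_left (k n : ℕ) :
    rogersMonomial (k + 1) n = X ^ (2 * n) * rogersMonomial k n := by
  induction n with
  | zero => simp [rogersMonomial]
  | succ n ih => rw [rogersMonomial_succ, rogersMonomial_succ, ih]; ring

theorem X_pow_dvd_rogersMonomial_succ (k n : ℕ) :
    (X : ℤ⟦X⟧) ^ (2 * k + n + 2) ∣ rogersMonomial k (n + 1) := by
  induction n with
  | zero => simp [rogersMonomial]
  | succ n ih =>
    rw [rogersMonomial_succ, show 2 * k + (n + 1) + 2 = 1 + (2 * k + n + 2) by ring, pow_add]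
    exact mul_dvd_mul (pow_dvd_pow _ (by omega)).neg_right ih

/-- Partial sums of Rogers' series
`∑ (-1) ^ n * X ^ (2 * k * n + n * (5 * n - 1) / 2) * [k + n, n] * (1 - X ^ (3 * (k + 2 * n + 1)))`. -/
noncomputable def rogersSum (k m : ℕ) : ℤ⟦X⟧ :=
  ∑ n ∈ Finset.range m,
    rogersMonomial k n * gaussBinom X (n + k) n * (1 - X ^ (3 * (k + 2 * n + 1)))

/-- The telescoping certificate for the recurrence of Rogers' series. -/
noncomputable def rogersCertificate (k n : ℕ) : ℤ⟦X⟧ :=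
  rogersMonomial k n * gaussBinom X (n + k) n * (1 - X ^ n) *
    (-1 - X ^ n - X ^ (k + 3 * n + 1) - X ^ (2 * k + 5 * n + 3) + X ^ (3 * k + 6 * n + 4))

/-- The $n$-th summands combine to the difference of consecutive certificates, and the factor
$1-X^n$ makes the certificate vanish at $n=0$. -/
theorem rogersSum_recurrence (k m : ℕ) :
    rogersSum k m - (1 - X ^ (k + 1)) * rogersSum (k + 1) m -
      X ^ (k + 1) * (1 - X ^ (k + 1)) * (1 - X ^ (k + 2)) * rogersSum (k + 2) m =
    rogersCertificate k m := by
  induction m with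
  | zero => simp [rogersSum, rogersCertificate]
  | succ n ih =>
    simp only [rogersSum] at ih ⊢
    rw [Finset.sum_range_succ, Finset.sum_range_succ, Finset.sum_range_succ]
    rw [rogersCertificate] at ih ⊢
    have h1 := one_sub_mul_gaussBinom_succ_left k n
    have h2 := one_sub_mul_gaussBinom_succ_left (k + 1) n
    have h3 := one_sub_mul_gaussBinom_succ_right k n
    rw [rogersMonomial_succ, rogersMonomial_succ_left (k + 1), rogersMonomial_succ_left k]
    rw [show k + 1 + 1 = k + 2 by ring] at h2
    generalize gaussBinom (X : ℤ⟦X⟧) (n + k) n = b at *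
    generalize gaussBinom (X : ℤ⟦X⟧) (n + (k + 1)) n = b1 at *
    generalize gaussBinom (X : ℤ⟦X⟧) (n + (k + 2)) n = b2 at *
    generalize gaussBinom (X : ℤ⟦X⟧) (n + 1 + k) (n + 1) = b3 at *
    generalize rogersMonomial k n = s at *
    simp only [pow_add, pow_mul', pow_one, mul_add] at *
    generalize (X : ℤ⟦X⟧) ^ k = x at *
    generalize (X : ℤ⟦X⟧) ^ n = y at *
    generalize (X : ℤ⟦X⟧) = q at *
    -- With $x=q^k$ and $y=q^n$ this is a polynomial identity modulo the relations `h1`, `h2`, `h3`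
    -- among neighbouring Gaussian binomials.
    linear_combination ih - y ^ 2 * s * (1 - x ^ 3 * y ^ 6 * q ^ 6) * h1 -
      x * q * y ^ 4 * s * (1 - x ^ 3 * y ^ 6 * q ^ 9) *
        ((1 - x * q) * h2 + (1 - x * y * q ^ 2) * h1) +
      x ^ 2 * y ^ 5 * q ^ 2 * s * (-1 - y * q - x * y ^ 3 * q ^ 4 - x ^ 2 * y ^ 5 * q ^ 8 +
        x ^ 3 * y ^ 6 * q ^ 10) * h3

theorem X_pow_dvd_rogersSum_sub_one (k m : ℕ) :
    (X : ℤ⟦X⟧) ^ (k + 1) ∣ rogersSum k (m + 1) - 1 := by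
  rw [rogersSum, Finset.sum_range_succ']
  have h0 : rogersMonomial k 0 * gaussBinom X (0 + k) 0 * (1 - X ^ (3 * (k + 2 * 0 + 1))) - 1 =
      -(X : ℤ⟦X⟧) ^ (3 * (k + 2 * 0 + 1)) := by
    simp [rogersMonomial, gaussBinom_zero_right]
  rw [add_sub_assoc, h0]
  refine dvd_add (Finset.dvd_sum fun n _ => ?_) ((pow_dvd_pow _ (by omega)).neg_right)
  exact (((pow_dvd_pow _ (by omega)).trans
    (X_pow_dvd_rogersMonomial_succ k n)).mul_right _).mul_right _

theorem X_pow_dvd_rogersCertificate (k m : ℕ) : (X : ℤ⟦X⟧) ^ m ∣ rogersCertificate k m := by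
  rcases m with _ | m
  · simp
  · exact ((((pow_dvd_pow _ (by omega)).trans
      (X_pow_dvd_rogersMonomial_succ k m)).mul_right _).mul_right _).mul_right _

/-- A solution of the Rogers–Ramanujan recurrence agrees with Rogers' series. -/
theorem X_pow_dvd_sub_rogersSum {N : ℕ} {A : ℕ → ℤ⟦X⟧}
    (hA : ∀ k, k + 2 ≤ N → A k = (1 - X ^ (k + 1)) * A (k + 1) +
      X ^ (k + 1) * (1 - X ^ (k + 1)) * (1 - X ^ (k + 2)) * A (k + 2))
    (hN : ∀ k, k ≤ N → N ≤ k + 1 → X ^ N ∣ A k - 1)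
    {k : ℕ} (hk : k ≤ N) : X ^ N ∣ A k - rogersSum k N := by
  rcases Nat.eq_zero_or_pos N with rfl | hpos
  · simp
  obtain ⟨d, hd⟩ : ∃ d, d = N - k := ⟨_, rfl⟩
  induction d using Nat.strong_induction_on generalizing k with
  | _ d ih =>
    rcases lt_or_ge (k + 1) N with h | h
    · have h1 := ih (N - (k + 1)) (by omega) (k := k + 1) (by omega) rfl
      have h2 := ih (N - (k + 2)) (by omega) (k := k + 2) (by omega) rfl
      have h3 := rogersSum_recurrence k N
      have h4 := X_pow_dvd_rogersCertificate k N
      rw [← h3] at h4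
      have e : A k - rogersSum k N = (1 - X ^ (k + 1)) * (A (k + 1) - rogersSum (k + 1) N) +
          X ^ (k + 1) * (1 - X ^ (k + 1)) * (1 - X ^ (k + 2)) * (A (k + 2) - rogersSum (k + 2) N) -
          (rogersSum k N - (1 - X ^ (k + 1)) * rogersSum (k + 1) N -
      X ^ (k + 1) * (1 - X ^ (k + 1)) * (1 - X ^ (k + 2)) * rogersSum (k + 2) N) := by
        rw [hA k (by omega)]; ring
      rw [e]
      exact ((h1.mul_left _).add (h2.mul_left _)).sub h4
    -- Only $k=N-1$ and $k=N$ remain, where both series are $1$ modulo $X^N$.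
    · obtain ⟨m, rfl⟩ := Nat.exists_eq_succ_of_ne_zero hpos.ne'
      rw [← sub_sub_sub_cancel_right _ _ 1]
      exact (hN k hk h).sub ((pow_dvd_pow _ h).trans (X_pow_dvd_rogersSum_sub_one k m))

/-- Rogers' series for `k = 1` is, up to the factor `1 - X`, a theta series. -/
theorem X_pow_dvd_one_sub_mul_rogersSum_one_sub (m : ℕ) :
    (X : ℤ⟦X⟧) ^ m ∣ (1 - X) * rogersSum 1 m - ∑ n ∈ Finset.range m,
      rogersMonomial 1 n * (1 - X ^ (2 * n + 1)) := by
  -- Since $(1-X)[n+1,n]=1-X^{n+1}$, the partial sums differ by a telescoping remainder.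
  have e : (1 - X) * rogersSum 1 m - ∑ n ∈ Finset.range m,
      rogersMonomial 1 n * (1 - X ^ (2 * n + 1)) =
      rogersMonomial 1 m * (X ^ (m + 1) * (1 - X ^ m)) := by
    induction m with
    | zero => simp [rogersSum]
    | succ n ih =>
      rw [rogersSum] at ih ⊢
      rw [Finset.sum_range_succ, Finset.sum_range_succ, rogersMonomial_succ]
      have h := one_sub_mul_gaussBinom_succ_left 0 n
      simp only [zero_add, pow_one, add_zero, gaussBinom_self] at h
      linear_combination ih + rogersMonomial 1 n * (1 - X ^ (3 * (1 + 2 * n + 1))) * h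
  rw [e]
  rcases m with _ | m
  · simp
  · exact ((pow_dvd_pow _ (by omega)).trans (X_pow_dvd_rogersMonomial_succ 1 m)).mul_right _

/-! ### The recurrence for signed edge sets -/

section Recurrence

/-- The multiset of vertices covered by the edges `{x_l, y_l}`, `l ∈ S`, and `{x_{h+1}, x_h}`,
`h ∈ T`, where `x_h` and `y_h` are both recorded as `h`. -/
def edgeCover (S T : Finset ℕ) : Multiset ℕ := (S ∪ T ∪ T.image Nat.succ).val + S.val

/-- The signed generating function of the finite edge sets on the vertices above `k`
(with `l, h ≤ N` for the edges `{x_l, y_l}` and `{x_{h+1}, x_h}`). -/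
noncomputable def edgeSeries (N k : ℕ) : ℤ⟦X⟧ :=
  ∑ S ∈ (Finset.Ioc k N).powerset, ∑ T ∈ (Finset.Ioc k N).powerset,
    (-1) ^ (S.card + T.card) * X ^ (edgeCover S T).sum

/-- The variant of `edgeSeries` in which the vertex `x_{k+1}` has weight `0`. -/
noncomputable def edgeSeriesErase (N k : ℕ) : ℤ⟦X⟧ :=
  ∑ S ∈ (Finset.Ioc k N).powerset, ∑ T ∈ (Finset.Ioc k N).powerset,
    (-1) ^ (S.card + T.card) *
      X ^ (∑ h ∈ (S ∪ T ∪ T.image Nat.succ).erase (k + 1), h + ∑ h ∈ S, h)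

theorem sum_edgeCover (S T : Finset ℕ) :
    (edgeCover S T).sum = ∑ h ∈ S ∪ T ∪ T.image Nat.succ, h + ∑ h ∈ S, h := by
  rw [edgeCover, Multiset.sum_add, Finset.sum_val, Finset.sum_val]
  rfl

theorem sum_insert_eq_add_sum_erase (a : ℕ) (s : Finset ℕ) :
    ∑ h ∈ insert a s, h = a + ∑ h ∈ s.erase a, h := by
  rw [← Finset.sum_insert (f := fun h => h) (Finset.notMem_erase a s)]
  congr 1
  ext
  simp
  tauto

theorem insert_succ_Ioc_succ {k N : ℕ} (h : k < N) :
    Finset.Ioc k N = insert (k + 1) (Finset.Ioc (k + 1) N) := by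
  ext; simp; omega

variable {k N : ℕ} {S T : Finset ℕ}

theorem notMem_of_subset_Ioc (hS : S ⊆ Finset.Ioc (k + 1) N) : k + 1 ∉ S := fun h => by
  simpa using hS h

theorem notMem_union_of_subset_Ioc (hS : S ⊆ Finset.Ioc (k + 1) N)
    (hT : T ⊆ Finset.Ioc (k + 1) N) : k + 1 ∉ S ∪ T ∪ T.image Nat.succ := by
  simp only [Finset.mem_union, Finset.mem_image, not_or, not_exists, not_and]
  refine ⟨⟨notMem_of_subset_Ioc hS, notMem_of_subset_Ioc hT⟩, fun a ha h => ?_⟩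
  have := hT ha
  simp at this
  omega

theorem insert_union_union (a : ℕ) :
    insert a S ∪ T ∪ T.image Nat.succ = insert a (S ∪ T ∪ T.image Nat.succ) := by
  simp [Finset.insert_union]

theorem union_insert_union (a : ℕ) :
    S ∪ insert a T ∪ (insert a T).image Nat.succ =
      insert a (insert (a + 1) (S ∪ T ∪ T.image Nat.succ)) := by
  ext; simp; tauto

theorem insert_union_insert_union (a : ℕ) :
    insert a S ∪ insert a T ∪ (insert a T).image Nat.succ =
      insert a (insert (a + 1) (S ∪ T ∪ T.image Nat.succ)) := by
  ext; simp; tauto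

/-- Four cases, by whether $k+1$ lies in $S$ and in $T$. If $k+1\in T$, then $x_{k+2}$ is already
covered and paid for, so it has weight $0$ in what remains. -/
theorem edgeSeries_eq (h : k < N) :
    edgeSeries N k = (1 - X ^ (2 * (k + 1))) * edgeSeries N (k + 1) -
      X ^ (2 * k + 3) * (1 - X ^ (k + 1)) * edgeSeriesErase N (k + 1) := by
  unfold edgeSeries edgeSeriesErase
  rw [insert_succ_Ioc_succ h, Finset.sum_powerset_insert (by simp)]
  simp_rw [Finset.sum_powerset_insert (show k + 1 ∉ Finset.Ioc (k + 1) N by simp)]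
  simp_rw [Finset.mul_sum]
  simp_rw [← Finset.sum_add_distrib, ← Finset.sum_sub_distrib]
  refine Finset.sum_congr rfl fun S hS => Finset.sum_congr rfl fun T hT => ?_
  have hS := Finset.mem_powerset.1 hS
  have hT := Finset.mem_powerset.1 hT
  have hU := notMem_union_of_subset_Ioc hS hT
  simp only [insert_union_insert_union, sum_edgeCover]
  simp only [insert_union_union, union_insert_union,
    Finset.card_insert_of_notMem (notMem_of_subset_Ioc hS),
    Finset.card_insert_of_notMem (notMem_of_subset_Ioc hT),
    Finset.sum_insert (notMem_of_subset_Ioc hS), Finset.sum_insert hU]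
  rw [Finset.sum_insert (by simpa using hU), sum_insert_eq_add_sum_erase (k + 1 + 1)]
  ring

theorem edgeSeriesErase_eq (h : k < N) :
    edgeSeriesErase N k = (1 - X ^ (k + 1)) *
      (edgeSeries N (k + 1) - X ^ (k + 2) * edgeSeriesErase N (k + 1)) := by
  unfold edgeSeries edgeSeriesErase
  rw [insert_succ_Ioc_succ h, Finset.sum_powerset_insert (by simp)]
  simp_rw [Finset.sum_powerset_insert (show k + 1 ∉ Finset.Ioc (k + 1) N by simp)]
  simp_rw [Finset.mul_sum, ← Finset.sum_sub_distrib, Finset.mul_sum]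
  simp_rw [← Finset.sum_add_distrib]
  refine Finset.sum_congr rfl fun S hS => Finset.sum_congr rfl fun T hT => ?_
  have hS := Finset.mem_powerset.1 hS
  have hT := Finset.mem_powerset.1 hT
  have hU := notMem_union_of_subset_Ioc hS hT
  have hU' : k + 1 ∉ insert (k + 1 + 1) (S ∪ T ∪ T.image Nat.succ) := by
    rw [Finset.mem_insert, not_or]; exact ⟨by omega, hU⟩
  simp only [insert_union_insert_union, sum_edgeCover]
  simp only [insert_union_union, union_insert_union,
    Finset.card_insert_of_notMem (notMem_of_subset_Ioc hS),
    Finset.card_insert_of_notMem (notMem_of_subset_Ioc hT), Finset.erase_insert hU,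
    Finset.erase_insert hU', Finset.erase_eq_of_notMem hU,
    Finset.sum_insert (notMem_of_subset_Ioc hS), sum_insert_eq_add_sum_erase (k + 1 + 1)]
  ring

/-- Writing $B$ for `edgeSeriesErase`, the two relations at level $k+1$ give
$A_{k+1}-X^{k+2}B_{k+1}=(1-X^{k+2})A_{k+2}$, which eliminates $B_{k+1}$ from the relation at level
$k$. -/
theorem edgeSeries_recurrence (h : k + 2 ≤ N) :
    edgeSeries N k = (1 - X ^ (k + 1)) * edgeSeries N (k + 1) +
      X ^ (k + 1) * (1 - X ^ (k + 1)) * (1 - X ^ (k + 2)) * edgeSeries N (k + 2) := by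
  have h1 := edgeSeries_eq (k := k) (N := N) (by omega)
  have h2 := edgeSeries_eq (k := k + 1) (N := N) (by omega)
  have h3 := edgeSeriesErase_eq (k := k + 1) (N := N) (by omega)
  rw [h1, h3, h2]
  ring

theorem edgeSeries_self (N : ℕ) : edgeSeries N N = 1 := by
  simp [edgeSeries, edgeCover]

theorem X_pow_dvd_edgeSeries_sub_rogersSum (h : k ≤ N) :
    X ^ N ∣ edgeSeries N k - rogersSum k N := by
  refine X_pow_dvd_sub_rogersSum (fun k hk => edgeSeries_recurrence hk) (fun k hk hk' => ?_) h
  rcases hk.eq_or_lt with rfl | hk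
  · simp [edgeSeries_self]
  · obtain rfl : N = k + 1 := by omega
    rw [edgeSeries_eq hk, edgeSeries_self]
    refine ⟨-X ^ (k + 1) - X ^ (k + 2) * (1 - X ^ (k + 1)) * edgeSeriesErase (k + 1) (k + 1), ?_⟩
    ring

end Recurrence

/-! ### Signatures as sums over edge sets -/

section Signature

variable {n : ℕ} {p : n.Partition} {S T : Finset ℕ}

theorem mem_edgeCover {h : ℕ} : h ∈ edgeCover S T ↔ h ∈ S ∨ h ∈ T ∨ ∃ t ∈ T, t + 1 = h := by
  simp [edgeCover]; tauto

theorem count_edgeCover (h : ℕ) : (edgeCover S T).count h =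
    (if h ∈ S ∨ h ∈ T ∨ ∃ t ∈ T, t + 1 = h then 1 else 0) + if h ∈ S then 1 else 0 := by
  rw [edgeCover, Multiset.count_add, Multiset.count_eq_of_nodup (Finset.nodup _),
    Multiset.count_eq_of_nodup (Finset.nodup _)]
  simp

theorem mk_false_mem_partitionVertices {h : ℕ} : (h, false) ∈ partitionVertices p ↔ h ∈ p.parts := by
  simp [partitionVertices]

theorem mk_true_mem_partitionVertices {h : ℕ} :
    (h, true) ∈ partitionVertices p ↔ p.parts.count h = 2 := by
  simp only [partitionVertices, Finset.mem_union, Finset.mem_image, Finset.mem_filter,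
    Multiset.mem_toFinset, Prod.mk.injEq, Bool.false_eq_true, and_false, exists_false, and_true,
    exists_eq_right, false_or, and_iff_right_iff_imp]
  intro h
  exact Multiset.count_pos.1 (by omega)

/-- The edges `{x_{h+1}, x_h}`, `h ∈ T`, and `{x_l, y_l}`, `l ∈ S`, with one orientation. -/
def EdgeRel (S T : Finset ℕ) (u v : ℕ × Bool) : Prop :=
  (∃ h ∈ T, u = (h + 1, false) ∧ v = (h, false)) ∨ ∃ l ∈ S, u = (l, false) ∧ v = (l, true)

theorem EdgeRel.ne {u v : ℕ × Bool} (h : EdgeRel S T u v) : u ≠ v := by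
  rintro rfl
  rcases h with ⟨h, -, h1, h2⟩ | ⟨h, -, h1, h2⟩ <;> rw [h1] at h2 <;> simp at h2

theorem EdgeRel.partitionGraph_adj {u v : partitionVertices p} (h : EdgeRel S T u v) :
    (partitionGraph p).Adj u v := by
  rw [partitionGraph, SimpleGraph.fromRel_adj]
  refine ⟨fun e => h.ne (congrArg _ e), Or.inl ?_⟩
  rcases h with ⟨h, -, h1⟩ | ⟨h, -, h1⟩
  exacts [Or.inl ⟨h, h1⟩, Or.inr ⟨h, h1⟩]

/-- The spanning subgraph of the graph of `p` whose edges are given by `S` and `T`. -/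
def edgeSubgraph (p : n.Partition) (S T : Finset ℕ) : (partitionGraph p).Subgraph where
  verts := Set.univ
  Adj u v := EdgeRel S T u v ∨ EdgeRel S T v u
  adj_sub h := h.elim (fun h => h.partitionGraph_adj) fun h => (EdgeRel.partitionGraph_adj h).symm
  edge_vert _ := Set.mem_univ _
  symm := ⟨fun _ _ h => h.symm⟩

open Classical in
/-- The parts `l` for which `{x_l, y_l}` is an edge of `H`. -/
noncomputable def verticalEdges (H : (partitionGraph p).Subgraph) : Finset ℕ :=
  p.parts.toFinset.filter fun l => ∃ u v, H.Adj u v ∧ u.1 = (l, false) ∧ v.1 = (l, true)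

open Classical in
/-- The parts `h` for which `{x_{h+1}, x_h}` is an edge of `H`. -/
noncomputable def horizontalEdges (H : (partitionGraph p).Subgraph) : Finset ℕ :=
  p.parts.toFinset.filter fun h => ∃ u v, H.Adj u v ∧ u.1 = (h + 1, false) ∧ v.1 = (h, false)

theorem mem_verticalEdges {H : (partitionGraph p).Subgraph} {l : ℕ} :
    l ∈ verticalEdges H ↔ ∃ u v, H.Adj u v ∧ u.1 = (l, false) ∧ v.1 = (l, true) := by
  simp only [verticalEdges, Finset.mem_filter, Multiset.mem_toFinset, and_iff_right_iff_imp]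
  rintro ⟨u, v, -, hu, -⟩
  exact mk_false_mem_partitionVertices.1 (hu ▸ u.2)

theorem mem_horizontalEdges {H : (partitionGraph p).Subgraph} {h : ℕ} :
    h ∈ horizontalEdges H ↔ ∃ u v, H.Adj u v ∧ u.1 = (h + 1, false) ∧ v.1 = (h, false) := by
  simp only [horizontalEdges, Finset.mem_filter, Multiset.mem_toFinset, and_iff_right_iff_imp]
  rintro ⟨u, v, -, -, hv⟩
  exact mk_false_mem_partitionVertices.1 (hv ▸ v.2)

theorem adj_of_edgeRel {H : (partitionGraph p).Subgraph} {u v : partitionVertices p}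
    (h : EdgeRel (verticalEdges H) (horizontalEdges H) u v) : H.Adj u v := by
  rcases h with ⟨h, hh, hu, hv⟩ | ⟨h, hh, hu, hv⟩
  · obtain ⟨u', v', hadj, hu', hv'⟩ := mem_horizontalEdges.1 hh
    rwa [Subtype.ext (hu'.trans hu.symm), Subtype.ext (hv'.trans hv.symm)] at hadj
  · obtain ⟨u', v', hadj, hu', hv'⟩ := mem_verticalEdges.1 hh
    rwa [Subtype.ext (hu'.trans hu.symm), Subtype.ext (hv'.trans hv.symm)] at hadj

theorem adj_iff_edgeRel {H : (partitionGraph p).Subgraph} {u v : partitionVertices p} :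
    H.Adj u v ↔ EdgeRel (verticalEdges H) (horizontalEdges H) u v ∨
      EdgeRel (verticalEdges H) (horizontalEdges H) v u := by
  constructor
  · intro hadj
    have hG := hadj.adj_sub
    rw [partitionGraph, SimpleGraph.fromRel_adj] at hG
    rcases hG.2 with (⟨h, h1, h2⟩ | ⟨h, h1, h2⟩) | (⟨h, h1, h2⟩ | ⟨h, h1, h2⟩)
    · exact Or.inl (Or.inl ⟨h, mem_horizontalEdges.2 ⟨u, v, hadj, h1, h2⟩, h1, h2⟩)
    · exact Or.inl (Or.inr ⟨h, mem_verticalEdges.2 ⟨u, v, hadj, h1, h2⟩, h1, h2⟩)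
    · exact Or.inr (Or.inl ⟨h, mem_horizontalEdges.2 ⟨v, u, hadj.symm, h1, h2⟩, h1, h2⟩)
    · exact Or.inr (Or.inr ⟨h, mem_verticalEdges.2 ⟨v, u, hadj.symm, h1, h2⟩, h1, h2⟩)
  · rintro (h | h)
    exacts [adj_of_edgeRel h, (adj_of_edgeRel h).symm]

theorem edgeSubgraph_verticalEdges_horizontalEdges {H : (partitionGraph p).Subgraph}
    (hH : H.IsSpanning) : edgeSubgraph p (verticalEdges H) (horizontalEdges H) = H := by
  refine SimpleGraph.Subgraph.ext (SimpleGraph.Subgraph.isSpanning_iff.1 hH).symm ?_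
  ext u v
  exact adj_iff_edgeRel.symm

theorem mem_parts_of_edgeCover_eq (hp : edgeCover S T = p.parts) :
    (∀ h ∈ T, h ∈ p.parts ∧ h + 1 ∈ p.parts) ∧ ∀ l ∈ S, l ∈ p.parts ∧ p.parts.count l = 2 := by
  refine ⟨fun h hh => ?_, fun l hl => ?_⟩
  · rw [← hp, mem_edgeCover, mem_edgeCover]
    exact ⟨Or.inr (Or.inl hh), Or.inr (Or.inr ⟨h, hh, rfl⟩)⟩
  · rw [← hp, mem_edgeCover, count_edgeCover]
    simp [hl]

theorem horizontalEdges_edgeSubgraph (hp : edgeCover S T = p.parts) :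
    horizontalEdges (edgeSubgraph p S T) = T := by
  ext h
  rw [mem_horizontalEdges]
  constructor
  · rintro ⟨u, v, huv, hu, hv⟩
    rcases huv with (⟨h', hh, h1, h2⟩ | ⟨h', hh, h1, h2⟩) | (⟨h', hh, h1, h2⟩ | ⟨h', hh, h1, h2⟩) <;>
      simp_all
    omega
  · intro hh
    have := (mem_parts_of_edgeCover_eq hp).1 h hh
    exact ⟨⟨_, mk_false_mem_partitionVertices.2 this.2⟩,
      ⟨_, mk_false_mem_partitionVertices.2 this.1⟩, Or.inl (Or.inl ⟨h, hh, rfl, rfl⟩), rfl, rfl⟩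

theorem verticalEdges_edgeSubgraph (hp : edgeCover S T = p.parts) :
    verticalEdges (edgeSubgraph p S T) = S := by
  ext h
  rw [mem_verticalEdges]
  constructor
  · rintro ⟨u, v, huv, hu, hv⟩
    rcases huv with (⟨h', hh, h1, h2⟩ | ⟨h', hh, h1, h2⟩) | (⟨h', hh, h1, h2⟩ | ⟨h', hh, h1, h2⟩) <;>
      simp_all
  · intro hh
    have := (mem_parts_of_edgeCover_eq hp).2 h hh
    exact ⟨⟨_, mk_false_mem_partitionVertices.2 this.1⟩,
      ⟨_, mk_true_mem_partitionVertices.2 this.2⟩, Or.inl (Or.inr ⟨h, hh, rfl, rfl⟩), rfl, rfl⟩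

theorem exists_adj_edgeSubgraph (hp : edgeCover S T = p.parts) (v : partitionVertices p) :
    ∃ w, (edgeSubgraph p S T).Adj v w := by
  have hT := (mem_parts_of_edgeCover_eq hp).1
  have hS := (mem_parts_of_edgeCover_eq hp).2
  obtain ⟨⟨h, _ | _⟩, hv⟩ := v
  · have hh := mk_false_mem_partitionVertices.1 hv
    rw [← hp, mem_edgeCover] at hh
    rcases hh with hh | hh | ⟨t, ht, rfl⟩
    · exact ⟨⟨_, mk_true_mem_partitionVertices.2 (hS h hh).2⟩, Or.inl (Or.inr ⟨h, hh, rfl, rfl⟩)⟩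
    · exact ⟨⟨_, mk_false_mem_partitionVertices.2 (hT h hh).2⟩, Or.inr (Or.inl ⟨h, hh, rfl, rfl⟩)⟩
    · exact ⟨⟨_, mk_false_mem_partitionVertices.2 (hT t ht).1⟩, Or.inl (Or.inl ⟨t, ht, rfl, rfl⟩)⟩
  · have hh := mk_true_mem_partitionVertices.1 hv
    rw [← hp, count_edgeCover] at hh
    have hh : h ∈ S := by
      by_contra hn
      rw [if_neg hn] at hh
      split_ifs at hh <;> omega
    exact ⟨⟨_, mk_false_mem_partitionVertices.2 (hS h hh).1⟩, Or.inr (Or.inr ⟨h, hh, rfl, rfl⟩)⟩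

/-- Every $x_h$ lies on an edge of $H$, and the only possible edge at $y_h$ is $\{x_h,y_h\}$, so the
parts of multiplicity $2$ are exactly the vertical edges. -/
theorem edgeCover_verticalEdges_horizontalEdges (hp : ∀ h ∈ p.parts, p.parts.count h ≤ 2)
    {H : (partitionGraph p).Subgraph} (hH : ∀ v, ∃ w, H.Adj v w) :
    edgeCover (verticalEdges H) (horizontalEdges H) = p.parts := by
  ext h
  have hmem : h ∈ p.parts ↔
      h ∈ verticalEdges H ∨ h ∈ horizontalEdges H ∨ ∃ t ∈ horizontalEdges H, t + 1 = h := by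
    constructor
    · intro hh
      obtain ⟨w, hw⟩ := hH ⟨_, mk_false_mem_partitionVertices.2 hh⟩
      rcases adj_iff_edgeRel.1 hw with
        (⟨t, ht, h1, h2⟩ | ⟨t, ht, h1, h2⟩) | (⟨t, ht, h1, h2⟩ | ⟨t, ht, h1, h2⟩)
      · exact Or.inr (Or.inr ⟨t, ht, (Prod.ext_iff.1 h1).1.symm⟩)
      · obtain rfl : h = t := (Prod.ext_iff.1 h1).1
        exact Or.inl ht
      · obtain rfl : h = t := (Prod.ext_iff.1 h2).1
        exact Or.inr (Or.inl ht)
      · simp at h2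
    · rintro (hh | hh | ⟨t, hh, rfl⟩)
      · obtain ⟨u, -, -, hu, -⟩ := mem_verticalEdges.1 hh
        exact mk_false_mem_partitionVertices.1 (hu ▸ u.2)
      · obtain ⟨-, v, -, -, hv⟩ := mem_horizontalEdges.1 hh
        exact mk_false_mem_partitionVertices.1 (hv ▸ v.2)
      · obtain ⟨u, -, -, hu, -⟩ := mem_horizontalEdges.1 hh
        exact mk_false_mem_partitionVertices.1 (hu ▸ u.2)
  have htwo : p.parts.count h = 2 ↔ h ∈ verticalEdges H := by
    constructor
    · intro hh
      obtain ⟨w, hw⟩ := hH ⟨_, mk_true_mem_partitionVertices.2 hh⟩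
      rcases adj_iff_edgeRel.1 hw with
        (⟨t, ht, h1, h2⟩ | ⟨t, ht, h1, h2⟩) | (⟨t, ht, h1, h2⟩ | ⟨t, ht, h1, h2⟩)
      · simp at h1
      · simp at h1
      · simp at h2
      · obtain rfl : h = t := (Prod.ext_iff.1 h2).1
        exact ht
    · intro hh
      obtain ⟨-, v, -, -, hv⟩ := mem_verticalEdges.1 hh
      exact mk_true_mem_partitionVertices.1 (hv ▸ v.2)
  simp only [count_edgeCover, ← hmem]
  simp only [← htwo]
  by_cases hh : h ∈ p.parts
  · have h1 := hp h hh
    have h2 := Multiset.count_pos.2 hh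
    rw [if_pos hh]
    split_ifs <;> omega
  · rw [if_neg hh, Multiset.count_eq_zero.2 hh]
    simp

theorem ncard_edgeSet_eq {H : (partitionGraph p).Subgraph} :
    H.edgeSet.ncard = (verticalEdges H).card + (horizontalEdges H).card := by
  classical
  have himage : Sym2.map Subtype.val '' H.edgeSet =
      (((verticalEdges H).image fun l => s((l, false), (l, true))) ∪
        (horizontalEdges H).image fun h => s((h + 1, false), (h, false)) : Finset _) := by
    ext e
    constructor
    · rintro ⟨e, he, rfl⟩
      induction e using Sym2.ind with
      | _ u v =>
        rw [SimpleGraph.Subgraph.mem_edgeSet, adj_iff_edgeRel] at he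
        simp only [Finset.coe_union, Finset.coe_image, Set.mem_union, Set.mem_image,
          Finset.mem_coe, Sym2.map_mk]
        rcases he with
          (⟨t, ht, h1, h2⟩ | ⟨t, ht, h1, h2⟩) | (⟨t, ht, h1, h2⟩ | ⟨t, ht, h1, h2⟩)
        · exact Or.inr ⟨t, ht, by rw [h1, h2]⟩
        · exact Or.inl ⟨t, ht, by rw [h1, h2]⟩
        · exact Or.inr ⟨t, ht, by rw [h1, h2, Sym2.eq_swap]⟩
        · exact Or.inl ⟨t, ht, by rw [h1, h2, Sym2.eq_swap]⟩
    · intro he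
      simp only [Finset.coe_union, Finset.coe_image, Set.mem_union, Set.mem_image,
          Finset.mem_coe] at he
      rcases he with ⟨t, ht, rfl⟩ | ⟨t, ht, rfl⟩
      · obtain ⟨u, v, huv, hu, hv⟩ := mem_verticalEdges.1 ht
        exact ⟨s(u, v), huv, by rw [Sym2.map_mk, hu, hv]⟩
      · obtain ⟨u, v, huv, hu, hv⟩ := mem_horizontalEdges.1 ht
        exact ⟨s(u, v), huv, by rw [Sym2.map_mk, hu, hv]⟩
  rw [← Set.ncard_image_of_injective _ (Sym2.map.injective Subtype.val_injective), himage,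
    Set.ncard_coe_finset, Finset.card_union_of_disjoint, Finset.card_image_of_injective,
    Finset.card_image_of_injective]
  · intro a b hab
    simp at hab
    omega
  · intro a b hab
    simpa using hab
  · rw [Finset.disjoint_left]
    intro e he he'
    obtain ⟨a, -, rfl⟩ := Finset.mem_image.1 he
    obtain ⟨b, -, hb⟩ := Finset.mem_image.1 he'
    simp at hb

/-- $H$ corresponds to its pair of vertical and horizontal edge sets. The box `B` lets all
partitions share one index set, so that the sums can be interchanged. -/
theorem signature_eq_sum (hp : ∀ h ∈ p.parts, p.parts.count h ≤ 2) {B : Finset ℕ}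
    (hB : ∀ h ∈ p.parts, h ∈ B) :
    signature p = ∑ x ∈ B.powerset ×ˢ B.powerset,
      if edgeCover x.1 x.2 = p.parts then (-1) ^ (x.1.card + x.2.card) else 0 := by
  classical
  rw [← Finset.sum_filter, signature]
  refine Finset.sum_bij' (fun H _ => (verticalEdges H.1, horizontalEdges H.1))
    (fun x hx => ⟨edgeSubgraph p x.1 x.2, fun _ => Set.mem_univ _, fun v _ =>
      exists_adj_edgeSubgraph (Finset.mem_filter.1 hx).2 v⟩) ?_ ?_ ?_ ?_ ?_
  · rintro ⟨H, hH, hH'⟩ -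
    rw [Finset.mem_filter, Finset.mem_product, Finset.mem_powerset, Finset.mem_powerset]
    refine ⟨⟨fun h hh => ?_, fun h hh => ?_⟩,
      edgeCover_verticalEdges_horizontalEdges hp fun v => hH' v (hH v)⟩
    · exact hB h (Multiset.mem_toFinset.1 (Finset.mem_of_mem_filter _ hh))
    · exact hB h (Multiset.mem_toFinset.1 (Finset.mem_of_mem_filter _ hh))
  · exact fun _ _ => Finset.mem_univ _
  · rintro ⟨H, hH, hH'⟩ -
    exact Subtype.ext (edgeSubgraph_verticalEdges_horizontalEdges hH)
  · intro x hx
    have hx := (Finset.mem_filter.1 hx).2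
    exact Prod.ext (verticalEdges_edgeSubgraph hx) (horizontalEdges_edgeSubgraph hx)
  · rintro ⟨H, hH, hH'⟩ -
    rw [ncard_edgeSet_eq]

theorem isNeighborly_of_edgeCover_eq {i N : ℕ} (hS : S ⊆ Finset.Ioc (2 - i) N)
    (hT : T ⊆ Finset.Ioc (2 - i) N) (hp : edgeCover S T = p.parts) : IsNeighborly i p := by
  rw [IsNeighborly, ← hp]
  refine ⟨fun h hh => ?_, fun h _ => ?_, fun h hh => ?_⟩
  · rcases mem_edgeCover.1 hh with hh | hh | ⟨t, ht, rfl⟩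
    · refine ⟨h, ?_, by simp⟩
      rw [← Multiset.count_pos, Multiset.count_erase_self, count_edgeCover]
      simp [hh]
    · refine ⟨h + 1, (Multiset.mem_erase_of_ne (by omega)).2
        (mem_edgeCover.2 (Or.inr (Or.inr ⟨h, hh, rfl⟩))), by simp⟩
    · refine ⟨t, (Multiset.mem_erase_of_ne (by omega)).2
        (mem_edgeCover.2 (Or.inr (Or.inl ht))), by simp⟩
  · rw [count_edgeCover]
    split_ifs <;> omega
  · rcases mem_edgeCover.1 hh with hh | hh | ⟨t, ht, rfl⟩
    · have := Finset.mem_Ioc.1 (hS hh); omega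
    · have := Finset.mem_Ioc.1 (hT hh); omega
    · have := Finset.mem_Ioc.1 (hT ht); omega

theorem sum_signature_eq_coeff_edgeSeries {i N : ℕ} (hi : i ≤ 2) (hN : n ≤ N) :
    ∑ p ∈ neighborlyPartitions i n, signature p = coeff n (edgeSeries N (2 - i)) := by
  classical
  set B := (Finset.Ioc (2 - i) N).powerset with hB
  have h1 : ∀ p ∈ neighborlyPartitions i n, signature p = ∑ x ∈ B ×ˢ B,
      if edgeCover x.1 x.2 = p.parts then (-1) ^ (x.1.card + x.2.card) else 0 := by
    intro p hp
    have hp := (Finset.mem_filter.1 hp).2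
    refine signature_eq_sum hp.2.1 fun h hh => Finset.mem_Ioc.2 ?_
    have h1 := hp.2.2 h hh
    have h2 := Nat.Partition.le_of_mem_parts hh
    omega
  rw [Finset.sum_congr rfl h1, Finset.sum_comm, Finset.sum_product, edgeSeries, map_sum]
  refine Finset.sum_congr rfl fun S hS => ?_
  rw [map_sum]
  refine Finset.sum_congr rfl fun T hT => ?_
  have hS := Finset.mem_powerset.1 hS
  have hT := Finset.mem_powerset.1 hT
  dsimp only
  have hcoeff : coeff n ((-1) ^ (S.card + T.card) * X ^ (edgeCover S T).sum : ℤ⟦X⟧) =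
      if n = (edgeCover S T).sum then (-1) ^ (S.card + T.card) else 0 := by
    rw [show ((-1) ^ (S.card + T.card) : ℤ⟦X⟧) = C ((-1) ^ (S.card + T.card)) by simp,
      coeff_C_mul, coeff_X_pow]
    simp
  rw [hcoeff]
  split_ifs with hn
  · have hpos : ∀ {h}, h ∈ edgeCover S T → 0 < h := by
      intro h hh
      rcases mem_edgeCover.1 hh with hh | hh | ⟨t, hh, rfl⟩
      · have := Finset.mem_Ioc.1 (hS hh); omega
      · have := Finset.mem_Ioc.1 (hT hh); omega
      · omega
    -- A pair $(S,T)$ of weight $n$ contributes to this partition alone, which is neighborly because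
    -- every covered vertex has a neighbour.
    let p₀ : n.Partition := ⟨edgeCover S T, hpos, hn.symm⟩
    rw [Finset.sum_eq_single p₀]
    · exact if_pos rfl
    · intro p _ hne
      exact if_neg fun h => hne (Nat.Partition.ext h.symm)
    · intro h
      exact absurd (Finset.mem_filter.2 ⟨Finset.mem_univ _,
        isNeighborly_of_edgeCover_eq hS hT rfl⟩) h
  · refine Finset.sum_eq_zero fun p _ => if_neg fun h => hn ?_
    rw [h, p.parts_sum]

end Signature

/-! ### The product side -/

open Classical in
/-- The character whose partition generating function is `∏ (1 - X ^ j)` over the integers `j`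
with `IsNumeratorIndex i j`. -/
noncomputable def numeratorCharacter (i h c : ℕ) : ℤ :=
  if c = 1 ∧ IsNumeratorIndex i h then -1 else 0

open Classical in
/-- The factor `1 - X ^ j` if `IsNumeratorIndex i j`, and `1` otherwise. -/
noncomputable def numeratorFactor (i j : ℕ) : ℤ⟦X⟧ :=
  if IsNumeratorIndex i j then 1 - X ^ j else 1

theorem coeff_genFun_numeratorCharacter (i n : ℕ) :
    coeff n (Nat.Partition.genFun (numeratorCharacter i)) =
      ∑ p ∈ numeratorPartitions i n, (-1 : ℤ) ^ Multiset.card p.parts := by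
  classical
  rw [Nat.Partition.coeff_genFun, numeratorPartitions, Finset.sum_filter]
  refine Finset.sum_congr rfl fun p _ => ?_
  simp only [Finsupp.prod, Multiset.toFinsupp_support, Multiset.toFinsupp_apply]
  split_ifs with hp
  · have h1 : ∀ h ∈ p.parts.toFinset, numeratorCharacter i h (p.parts.count h) = -1 := by
      intro h hh
      rw [Multiset.mem_toFinset] at hh
      exact if_pos ⟨Multiset.count_eq_one_of_mem hp.1 hh, hp.2 h hh⟩
    rw [Finset.prod_congr rfl h1, Finset.prod_const, Multiset.toFinset_card_of_nodup hp.1]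
  · rw [Finset.prod_eq_zero_iff]
    by_contra hne
    push Not at hne
    refine hp ⟨Multiset.nodup_iff_count_le_one.2 fun h => ?_, fun h hh => ?_⟩
    · by_cases hh : h ∈ p.parts
      · have := hne h (Multiset.mem_toFinset.2 hh)
        simp only [numeratorCharacter, ne_eq, ite_eq_right_iff, Classical.not_imp] at this
        exact this.1.1.le
      · simp [Multiset.count_eq_zero.2 hh]
    · have := hne h (Multiset.mem_toFinset.2 hh)
      simp only [numeratorCharacter, ne_eq, ite_eq_right_iff, Classical.not_imp] at this
      exact this.1.2

theorem hasProd_numeratorFactor (i : ℕ) :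
    HasProd (fun j => numeratorFactor i (j + 1))
      (Nat.Partition.genFun (numeratorCharacter i)) := by
  have h := Nat.Partition.hasProd_genFun (numeratorCharacter i)
  refine (congrArg (HasProd · _) (funext fun j => ?_)).mp h
  -- The index $c$ stands for multiplicity $c+1$, so only $c=0$ survives.
  rw [tsum_eq_single 0 (fun c hc => by simp [numeratorCharacter, hc, smul_eq_C_mul])]
  by_cases hj : IsNumeratorIndex i (j + 1)
  · simp [numeratorFactor, numeratorCharacter, hj, sub_eq_add_neg, smul_eq_C_mul]
  · simp [numeratorFactor, numeratorCharacter, hj, smul_eq_C_mul]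

theorem IsNumeratorIndex.pos {i j : ℕ} (hi : i ≤ 2) (h : IsNumeratorIndex i j) : 0 < j := by
  have := h.1
  omega

theorem hasProd_one_sub_X_pow_numeratorIndex {i : ℕ} (hi : i ≤ 2) :
    HasProd (fun j : {j : ℕ // IsNumeratorIndex i j} => (1 - X ^ (j : ℕ) : ℤ⟦X⟧))
      (Nat.Partition.genFun (numeratorCharacter i)) := by
  have hinj : Function.Injective fun j : {j : ℕ // IsNumeratorIndex i j} => (j : ℕ) - 1 := by
    intro a b hab
    have ha := a.2.pos hi
    have hb := b.2.pos hi
    simp only at hab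
    exact Subtype.ext (by omega)
  have h := (hinj.hasProd_iff (f := fun j => numeratorFactor i (j + 1)) fun j hj => if_neg fun h =>
    hj ⟨⟨j + 1, h⟩, rfl⟩).2 (hasProd_numeratorFactor i)
  convert h using 2 with j
  have hj := j.2.pos hi
  simp only [Function.comp_apply, Nat.sub_add_cancel hj]
  exact (if_pos j.2).symm

/-- Convergence is coefficientwise in a discrete ring, so each coefficient of the partial products
is eventually constant. Length $5m$ gives whole blocks of residues. -/
theorem exists_coeff_genFun_numeratorCharacter (i n : ℕ) :
    ∃ m, n ≤ m ∧ 0 < m ∧ coeff n (Nat.Partition.genFun (numeratorCharacter i)) =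
      coeff n (∏ j ∈ Finset.range (5 * m), numeratorFactor i (j + 1)) := by
  have h := (PowerSeries.WithPiTopology.tendsto_iff_coeff_tendsto ..).1
    (hasProd_numeratorFactor i).tendsto_prod_nat n
  rw [nhds_discrete, Filter.tendsto_pure] at h
  obtain ⟨m, hm⟩ := Filter.eventually_atTop.1 h
  exact ⟨m + n + 1, by omega, by omega, (hm _ (by omega)).symm⟩

theorem prod_range_five_mul (f : ℕ → ℤ⟦X⟧) (m : ℕ) :
    ∏ j ∈ Finset.range (5 * m), f (j + 1) = ∏ l ∈ Finset.range m,
      (f (5 * l + 1) * f (5 * l + 2) * f (5 * l + 3) * f (5 * l + 4) * f (5 * l + 5)) := by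
  induction m with
  | zero => simp
  | succ m ih =>
    rw [Finset.prod_range_succ, ← ih, show 5 * (m + 1) = 5 * m + 1 + 1 + 1 + 1 + 1 by ring]
    simp only [Finset.prod_range_succ, add_assoc, Nat.reduceAdd]
    ring

theorem prod_numeratorFactor_two (m : ℕ) :
    ∏ j ∈ Finset.range (5 * m), numeratorFactor 2 (j + 1) = ∏ l ∈ Finset.range m,
      ((1 - X ^ ((3 + 2) * (l + 1))) * (1 - X ^ ((3 + 2) * l + 3)) *
        (1 - X ^ ((3 + 2) * l + 2))) := by
  rw [prod_range_five_mul]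
  refine Finset.prod_congr rfl fun l _ => ?_
  rw [numeratorFactor, if_neg (by simp only [IsNumeratorIndex, Int.ModEq]; omega),
    numeratorFactor, if_pos (by simp only [IsNumeratorIndex, Int.ModEq]; omega),
    numeratorFactor, if_pos (by simp only [IsNumeratorIndex, Int.ModEq]; omega),
    numeratorFactor, if_neg (by simp only [IsNumeratorIndex, Int.ModEq]; omega),
    numeratorFactor, if_pos (by simp only [IsNumeratorIndex, Int.ModEq]; omega)]
  ring

/-- For $i=1$ the bound $j\ge 2$ drops $j=1$ from its residue class; the factor $1-X$ restores it.
-/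
theorem one_sub_X_mul_prod_numeratorFactor_one {m : ℕ} (hm : 0 < m) :
    (1 - X) * ∏ j ∈ Finset.range (5 * m), numeratorFactor 1 (j + 1) = ∏ l ∈ Finset.range m,
      ((1 - X ^ ((1 + 4) * (l + 1))) * (1 - X ^ ((1 + 4) * l + 1)) *
        (1 - X ^ ((1 + 4) * l + 4))) := by
  obtain ⟨m, rfl⟩ := Nat.exists_eq_succ_of_ne_zero hm.ne'
  rw [prod_range_five_mul, Finset.prod_range_succ', Finset.prod_range_succ', mul_left_comm]
  congr 1
  · refine Finset.prod_congr rfl fun l _ => ?_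
    rw [numeratorFactor, if_pos (by simp only [IsNumeratorIndex, Int.ModEq]; omega),
      numeratorFactor, if_neg (by simp only [IsNumeratorIndex, Int.ModEq]; omega),
      numeratorFactor, if_neg (by simp only [IsNumeratorIndex, Int.ModEq]; omega),
      numeratorFactor, if_pos (by simp only [IsNumeratorIndex, Int.ModEq]; omega),
      numeratorFactor, if_pos (by simp only [IsNumeratorIndex, Int.ModEq]; omega)]
    ring
  · rw [numeratorFactor, if_neg (by simp only [IsNumeratorIndex, Int.ModEq]; omega),
      numeratorFactor, if_neg (by simp only [IsNumeratorIndex, Int.ModEq]; omega),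
      numeratorFactor, if_neg (by simp only [IsNumeratorIndex, Int.ModEq]; omega),
      numeratorFactor, if_pos (by simp only [IsNumeratorIndex, Int.ModEq]; omega),
      numeratorFactor, if_pos (by simp only [IsNumeratorIndex, Int.ModEq]; omega)]
    ring

/-! ### Comparison of the two sides -/

theorem X_pow_dvd_edgeSeries_sub_prod_two (m : ℕ) :
    (X : ℤ⟦X⟧) ^ (m + 1) ∣
      edgeSeries (m + 1) 0 - ∏ j ∈ Finset.range (5 * m), numeratorFactor 2 (j + 1) := by
  have h1 := X_pow_dvd_edgeSeries_sub_rogersSum (k := 0) (N := m + 1) (by omega)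
  have h2 := X_pow_dvd_tripleProduct_sub_sum (a := 3) (b := 2) (by omega) (by omega) m
  rw [← prod_numeratorFactor_two] at h2
  have h3 : rogersSum 0 (m + 1) = ∑ j ∈ Finset.range (m + 1),
      (∏ i ∈ Finset.range j, -(X : ℤ⟦X⟧) ^ ((3 + 2) * i + 2)) * (1 - X ^ (3 * (2 * j + 1))) := by
    refine Finset.sum_congr rfl fun j _ => ?_
    simp [rogersMonomial, gaussBinom_self]
  rw [h3] at h1
  have := h1.sub h2
  rwa [sub_sub_sub_cancel_right] at this

theorem X_pow_dvd_edgeSeries_sub_prod_one {m : ℕ} (hm : 0 < m) :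
    (X : ℤ⟦X⟧) ^ (m + 1) ∣
      edgeSeries (m + 1) 1 - ∏ j ∈ Finset.range (5 * m), numeratorFactor 1 (j + 1) := by
  have h1 := X_pow_dvd_edgeSeries_sub_rogersSum (k := 1) (N := m + 1) (by omega)
  have h2 := X_pow_dvd_tripleProduct_sub_sum (a := 1) (b := 4) (by omega) (by omega) m
  have h3 := X_pow_dvd_one_sub_mul_rogersSum_one_sub (m + 1)
  rw [← one_sub_X_mul_prod_numeratorFactor_one hm] at h2
  have h4 : ∑ n ∈ Finset.range (m + 1), rogersMonomial 1 n * (1 - X ^ (2 * n + 1)) =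
      ∑ j ∈ Finset.range (m + 1),
        (∏ i ∈ Finset.range j, -(X : ℤ⟦X⟧) ^ ((1 + 4) * i + 4)) * (1 - X ^ (1 * (2 * j + 1))) := by
    refine Finset.sum_congr rfl fun j _ => ?_
    rw [rogersMonomial, one_mul]
    congr 1
    refine Finset.prod_congr rfl fun i _ => ?_
    ring
  rw [h4] at h3
  have h5 := ((h1.mul_left (1 - X)).add h3).sub h2
  have hu : IsUnit (1 - X : ℤ⟦X⟧) := by
    rw [PowerSeries.isUnit_iff_constantCoeff]
    simp
  -- The theta form is available only after multiplication by $1-X$, a unit that is cancelled here.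
  rw [← hu.dvd_mul_left]
  convert h5 using 1
  ring

theorem coeff_edgeSeries_eq_coeff_prod {i m n : ℕ} (hi : i = 1 ∨ i = 2) (hm : 0 < m)
    (hn : n ≤ m) : coeff n (edgeSeries (m + 1) (2 - i)) =
      coeff n (∏ j ∈ Finset.range (5 * m), numeratorFactor i (j + 1)) := by
  rw [← sub_eq_zero, ← map_sub]
  refine X_pow_dvd_iff.1 ?_ n (Nat.lt_succ_iff.2 hn)
  rcases hi with rfl | rfl
  · exact X_pow_dvd_edgeSeries_sub_prod_one hm
  · exact X_pow_dvd_edgeSeries_sub_prod_two m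

theorem sum_signature_eq_coeff_genFun {i : ℕ} (hi : i = 1 ∨ i = 2) (n : ℕ) :
    ∑ p ∈ neighborlyPartitions i n, signature p =
      coeff n (Nat.Partition.genFun (numeratorCharacter i)) := by
  obtain ⟨m, hn, hm, h⟩ := exists_coeff_genFun_numeratorCharacter i n
  rw [h, sum_signature_eq_coeff_edgeSeries (N := m + 1) (by omega) (by omega),
    coeff_edgeSeries_eq_coeff_prod hi hm hn]

/-! ### Convergence and the power series identity -/

theorem hasSum_coeff_monomial_signature (i d : ℕ) :
    HasSum (fun p : allNeighborlyPartitions i => coeff d (monomial p.1.1 (signature p.1.2)))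
      (if d = 0 then 0 else ∑ p ∈ neighborlyPartitions i d, signature p) := by
  classical
  refine (hasSum_subtype_iff_indicator (f := fun p : Σ n : ℕ, n.Partition =>
    coeff d (monomial p.1 (signature p.2)))).2 ?_
  rw [← (sigma_mk_injective (i := d)).hasSum_iff]
  · have h := hasSum_fintype ((allNeighborlyPartitions i).indicator
      (fun p : Σ n : ℕ, n.Partition => coeff d (monomial p.1 (signature p.2))) ∘ Sigma.mk d)
    refine (congrArg (HasSum _ · _) ?_).mp h
    rw [neighborlyPartitions, Finset.sum_filter]
    split_ifs with hd
    · refine Finset.sum_eq_zero fun p _ => Set.indicator_of_notMem ?_ _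
      exact fun h => h.1.ne' hd
    · refine Finset.sum_congr rfl fun p _ => ?_
      simp [Set.indicator, allNeighborlyPartitions, Nat.pos_of_ne_zero hd, coeff_monomial]
  · rintro ⟨n, p⟩ hp
    have hne : d ≠ n := by
      rintro rfl
      exact hp ⟨p, rfl⟩
    refine Set.indicator_apply_eq_zero.2 fun _ => ?_
    simp [coeff_monomial, hne]

theorem hasSum_monomial_signature (i : ℕ) :
    HasSum (fun p : allNeighborlyPartitions i => monomial p.1.1 (signature p.1.2))
      (PowerSeries.mk fun n => if n = 0 then 0 else
        ∑ p ∈ neighborlyPartitions i n, signature p : ℤ⟦X⟧) := by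
  rw [PowerSeries.WithPiTopology.hasSum_iff_hasSum_coeff]
  intro d
  rw [coeff_mk]
  exact hasSum_coeff_monomial_signature i d

theorem theorem2 (i : ℕ) (hi : i = 1 ∨ i = 2) :
    (∀ n : ℕ, 0 < n →
      ∑ p ∈ neighborlyPartitions i n, signature p =
        ∑ p ∈ numeratorPartitions i n, (-1 : ℤ) ^ Multiset.card p.parts) ∧
    Summable (fun p : allNeighborlyPartitions i =>
      PowerSeries.monomial p.1.1 (signature p.1.2)) ∧
    Multipliable (fun j : {j : ℕ // IsNumeratorIndex i j} =>
      (1 - PowerSeries.X ^ (j : ℕ) : PowerSeries ℤ)) ∧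
    1 + ∑' p : allNeighborlyPartitions i, PowerSeries.monomial p.1.1 (signature p.1.2) =
      ∏' j : {j : ℕ // IsNumeratorIndex i j}, (1 - PowerSeries.X ^ (j : ℕ) : PowerSeries ℤ) := by
  have hprod := hasProd_one_sub_X_pow_numeratorIndex (i := i) (by omega)
  have hsum := hasSum_monomial_signature i
  refine ⟨fun n _ => ?_, hsum.summable, hprod.multipliable, ?_⟩
  · rw [sum_signature_eq_coeff_genFun hi, coeff_genFun_numeratorCharacter]
  · rw [hsum.tsum_eq, hprod.tprod_eq]
    ext n
    rw [map_add, coeff_mk, coeff_one]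
    split_ifs with hn
    -- In degree $0$ the sum contributes nothing, and the summand $1$ matches the empty partition on
    -- the product side.
    · subst hn
      simp [Nat.Partition.coeff_genFun]
    · rw [zero_add, sum_signature_eq_coeff_genFun hi]
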